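/- \textbf{Definitions.} An infinite variable word over a finite alphabet $A$ is an $\omega$-sequence $W$ of elements of $A\cup\{x_i : i\in\mathbb{N}\}$ in which every variable $x_i$ occurs at least once and only finitely often, and in which the first occurrence of $x_i$ comes before the first occurrence of $x_{i+1}$, for every $i$. For $\bar a=a_0\cdots a_{k-1}\in A^{<\omega}$, $W(\bar a)\in A^{<\omega}$ denotes the string obtained by replacing each $x_i$ by $a_i$ in $W$ and truncating the result just before the first occurrence of $x_k$. An instance of $\mathsf{Seq\,OVW}(2,2)$ is a sequence $c_0,c_1,\dots$ of colorings $c_i:A^{<\omega}\to\{0,1\}$, where $A=\{0,1\}$; it is computable if $(i,\sigma)\mapsto c_i(\sigma)$ is computable. A solution is an infinite variable word $W$ over $A$ (not required to be ordered; ordered variable words, in which all occurrences of $x_i$ precede all occurrences of $x_{i+1}$, are included) such that for every $i\in\mathbb{N}$ and every $\bar b\in A^i$, the set $\{W(\bar b\bar a):\bar a\in A^{<\omega}\}$ is monochromatic for $c_i$. A Turing degree $\mathbf d$ is PA relative to $X$ if every infinite $X$-computable tree $T\subseteq 2^{<\omega}$ has a $\mathbf d$-computable infinite path. \textbf{Theorem.}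 There is a computable instance $c_0,c_1,\dots$ of $\mathsf{Seq\,OVW}(2,2)$ such that every solution $W$ is of PA degree relative to $\emptyset'$. -/

import Mathlib

open Encodable

/-- The position of the first occurrence of the variable `x_k` in the `ω`-word `W` over
`A ∪ {x_0, x_1, …}`; the letter `a` is `Sum.inl a` and the variable `x_i` is `Sum.inr i`. -/
noncomputable def firstOcc {A : Type*} (W : ℕ → A ⊕ ℕ) (k : ℕ) : ℕ :=
  sInf {p | W p = Sum.inr k}

/-- Infinite variable words over the alphabet `A`. -/
structure IsInfiniteVariableWord {A : Type*} (W : ℕ → A ⊕ ℕ) : Prop where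
  occurs : ∀ i, {p | W p = Sum.inr i}.Nonempty
  finitely_often : ∀ i, {p | W p = Sum.inr i}.Finite
  first_lt : ∀ i, firstOcc W i < firstOcc W (i + 1)

/-- The `A`-string `W(a)`: each `x_i` is replaced by the entry `a i`, and the result is truncated
just before the first occurrence of `x_k`, where `k` is the length of `a`. (In a variable word only
`x_i` with `i < k` occur before that position, so the default value of `getD` is never used.) -/
noncomputable def substWord {A : Type*} [Inhabited A] (W : ℕ → A ⊕ ℕ) (a : List A) : List A :=
  (List.range (firstOcc W a.length)).map fun p => Sum.elim id (fun i => a.getD i default) (W p)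

/-- `W` is a solution of the instance `c 0, c 1, …` of `Seq OVW`: it is an infinite variable word
such that for every `i` and every `b ∈ A ^ i` the set `{W(b a) : a ∈ A^{<ω}}` is monochromatic for
`c i`. The variable word is not required to be ordered: the ordered variable words with this
property are among the solutions in the present sense. -/
def IsSeqOVWSolution {A κ : Type*} [Inhabited A] (c : ℕ → List A → κ) (W : ℕ → A ⊕ ℕ) : Prop :=
  IsInfiniteVariableWord W ∧
    ∀ (i : ℕ) (b : List A), b.length = i →
      ∃ color : κ, ∀ a : List A, c i (substWord W (b ++ a)) = color

/-- The characteristic function of the halting set `∅'`, the set of all `e` such that the `e`-th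
partial recursive function is defined at `e`. -/
noncomputable def zeroJump (e : ℕ) : ℕ :=
  open Classical in
  if ((Denumerable.ofNat Nat.Partrec.Code e).eval e).Dom then 1 else 0

/-- The (decidable) set of binary strings `{σ | T σ = true}` is an infinite binary tree. -/
def IsInfiniteBinaryTree (T : List Bool → Bool) : Prop :=
  (∀ σ τ : List Bool, σ <+: τ → T τ = true → T σ = true) ∧ {σ | T σ = true}.Infinite

/-- The infinite binary sequence `f` is a path through `T`. -/
def IsTreePath (T : List Bool → Bool) (f : ℕ → Bool) : Prop :=
  ∀ n, T ((List.range n).map f) = true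

/-- The Turing degree of `P` is PA relative to `X`: every infinite `X`-computable binary tree has a
`P`-computable path. -/
def IsPARelativeTo (X P : ℕ → ℕ) : Prop :=
  ∀ T : List Bool → Bool, ComputableIn {(X : ℕ →. ℕ)} T → IsInfiniteBinaryTree T →
    ∃ f : ℕ → Bool, ComputableIn {(P : ℕ →. ℕ)} f ∧ IsTreePath T f

/-! Let `c i` color a string by its length alone, through the bit `antiLimit i`. For a solution `W`,
the lengths of the strings `W(b a)` with `|b| = i` are the first occurrences of the variables from
`x_i` on. They are unbounded, so the constant color of `c i` is the limit of `antiLimit i` whenever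
this limit exists (`IsSeqOVWSolution.eq_of_eventually`), and it can be read off at length `firstOcc
W i`. Thus `W` computes bits that avoid all 0-1-valued limits of primitive recursive approximations
(`eventually_antiLimit`): a diagonally noncomputable 0-1-valued function relative to `∅'`. Such bits
compute paths. The limit lemma `exists_isLimitApprox` approximates a given `∅'`-computable infinite
tree. Which child of a string dies first is then a limit guess, and avoiding it leads to an
extendible child (`IsExtendible.child_of_limit`). Iteration gives the path. -/

open Filter Nat.Partrec

/-! ### Limit lemma -/

/-- The primitive recursive functions `F · 0, F · 1, …` converge pointwise to the partial function
`f` on its domain. -/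
def IsLimitApprox (f : ℕ →. ℕ) (F : ℕ → ℕ → ℕ) : Prop :=
  Primrec₂ F ∧ ∀ x v, v ∈ f x → ∀ᶠ s in atTop, F x s = v

theorem isLimitApprox_zeroJump :
    IsLimitApprox (zeroJump : ℕ →. ℕ) fun e s =>
      if ((Denumerable.ofNat Code e).evaln s e).isSome = true then 1 else 0 := by
  refine ⟨?_, ?_⟩
  · refine Primrec.ite (Primrec.eq.comp ?_ (Primrec.const true)) (Primrec.const 1)
      (Primrec.const 0)
    exact Primrec.option_isSome.comp (Code.primrec_evaln.comp
      ((Primrec.snd.pair ((Primrec.ofNat Code).comp Primrec.fst)).pair Primrec.fst))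
  · intro e v hv
    obtain rfl : v = zeroJump e := by simpa using hv
    unfold zeroJump
    by_cases h : ((Denumerable.ofNat Code e).eval e).Dom
    · obtain ⟨w, hw⟩ := Part.dom_iff_mem.1 h
      obtain ⟨k, hk⟩ := Code.evaln_complete.1 hw
      filter_upwards [eventually_ge_atTop k] with s hs
      have := Code.evaln_mono hs hk
      rw [Option.mem_def] at this
      simp [h, this]
    · refine Eventually.of_forall fun s => ?_
      have : (Denumerable.ofNat Code e).evaln s e = Option.none := by
        rw [Option.eq_none_iff_forall_not_mem]
        exact fun w hw => h (Part.dom_iff_mem.2 ⟨w, Code.evaln_sound hw⟩)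
      simp [h, this]

/-- The limit lemma: functions recursive in limits of primitive recursive functions are such limits
themselves. -/
theorem exists_isLimitApprox {O : Set (ℕ →. ℕ)} (hO : ∀ g ∈ O, ∃ G, IsLimitApprox g G)
    {f : ℕ →. ℕ} (hf : Nat.RecursiveIn O f) : ∃ F, IsLimitApprox f F := by
  induction hf with
  | zero =>
    refine ⟨fun _ _ => 0, Primrec.const 0, fun x v hv => Eventually.of_forall fun s => ?_⟩
    exact (Part.mem_some_iff.1 hv).symm
  | succ =>
    refine ⟨fun x _ => x.succ, Primrec.succ.comp Primrec.fst,
      fun x v hv => Eventually.of_forall fun s => ?_⟩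
    exact (Part.mem_some_iff.1 hv).symm
  | left =>
    refine ⟨fun x _ => x.unpair.1, Primrec.fst.comp (Primrec.unpair.comp Primrec.fst),
      fun x v hv => Eventually.of_forall fun s => ?_⟩
    exact (Part.mem_some_iff.1 hv).symm
  | right =>
    refine ⟨fun x _ => x.unpair.2, Primrec.snd.comp (Primrec.unpair.comp Primrec.fst),
      fun x v hv => Eventually.of_forall fun s => ?_⟩
    exact (Part.mem_some_iff.1 hv).symm
  | oracle g hg => exact hO g hg
  | pair _ _ ihf ihh =>
    obtain ⟨F, hF, hFl⟩ := ihf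
    obtain ⟨H, hH, hHl⟩ := ihh
    refine ⟨fun x s => Nat.pair (F x s) (H x s), Primrec₂.natPair.comp hF hH, fun x v hv => ?_⟩
    simp only [Seq.seq, Part.map_eq_map, Part.bind_map, Part.mem_bind_iff, Part.mem_map_iff] at hv
    obtain ⟨a, ha, b, hb, rfl⟩ := hv
    filter_upwards [hFl x a ha, hHl x b hb] with s h₁ h₂
    rw [h₁, h₂]
  | comp _ _ ihf ihh =>
    obtain ⟨F, hF, hFl⟩ := ihf
    obtain ⟨H, hH, hHl⟩ := ihh
    refine ⟨fun x s => F (H x s) s, hF.comp hH Primrec.snd, fun x v hv => ?_⟩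
    obtain ⟨a, ha, hv⟩ := Part.mem_bind_iff.1 hv
    filter_upwards [hFl a v hv, hHl x a ha] with s h₁ h₂
    rw [h₂, h₁]
  | prec _ _ ihf ihh =>
    obtain ⟨F, hF, hFl⟩ := ihf
    obtain ⟨H, hH, hHl⟩ := ihh
    refine ⟨fun x s => Nat.rec (F x.unpair.1 s)
      (fun y r => H (Nat.pair x.unpair.1 (Nat.pair y r)) s) x.unpair.2, ?_, fun x v hv => ?_⟩
    · refine Primrec.nat_rec' (f := fun p : ℕ × ℕ => p.1.unpair.2)
        (g := fun p : ℕ × ℕ => F p.1.unpair.1 p.2)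
        (h := fun (p : ℕ × ℕ) (q : ℕ × ℕ) => H (Nat.pair p.1.unpair.1 (Nat.pair q.1 q.2)) p.2)
        (Primrec.snd.comp (Primrec.unpair.comp Primrec.fst))
        (hF.comp (Primrec.fst.comp (Primrec.unpair.comp Primrec.fst)) Primrec.snd)
        (hH.comp (Primrec₂.natPair.comp
          (Primrec.fst.comp (Primrec.unpair.comp (Primrec.fst.comp Primrec.fst)))
          (Primrec₂.natPair.comp (Primrec.fst.comp Primrec.snd) (Primrec.snd.comp Primrec.snd)))
          (Primrec.snd.comp Primrec.fst))
    · revert hv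
      dsimp only
      generalize x.unpair.1 = a
      generalize x.unpair.2 = n
      induction n generalizing v with
      | zero => exact hFl a v
      | succ n ih =>
        intro hv
        obtain ⟨r, hr, hv⟩ := Part.mem_bind_iff.1 hv
        filter_upwards [ih r hr, hHl _ v hv] with s h₁ h₂
        rw [← h₂]
        exact congrArg (fun r => H (Nat.pair a (Nat.pair n r)) s) h₁
  | rfind _ ihf =>
    obtain ⟨F, hF, hFl⟩ := ihf
    -- The search is bounded by `s` to stay primitive recursive; a failed search returns `s`, which
    -- no longer happens once `s` exceeds the true value and the guesses up to it have settled.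
    refine ⟨fun x s => (List.range s).findIdx fun n => decide (F (Nat.pair x n) s = 0), ?_,
      fun x v hv => ?_⟩
    · refine Primrec.list_findIdx (Primrec.list_range.comp Primrec.snd) ?_
      refine (PrimrecPred.decide (Primrec.eq.comp (hF.comp (Primrec₂.natPair.comp
        (Primrec.fst.comp Primrec.fst) Primrec.snd) (Primrec.snd.comp Primrec.fst))
        (Primrec.const 0)))
    · obtain ⟨hv, hlt⟩ := Nat.mem_rfind.1 hv
      have h₁ : ∀ᶠ s in atTop, F (Nat.pair x v) s = 0 := by
        obtain ⟨m, hm, h⟩ := (Part.mem_map_iff _).1 hv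
        have : m = 0 := by simpa using h
        exact this ▸ hFl _ m hm
      have h₂ : ∀ᶠ s in atTop, ∀ n ∈ Finset.range v, F (Nat.pair x n) s ≠ 0 := by
        rw [eventually_all_finset]
        intro n hn
        obtain ⟨m, hm, h⟩ := (Part.mem_map_iff _).1 (hlt (Finset.mem_range.1 hn))
        have : m ≠ 0 := by simpa using h
        filter_upwards [hFl _ m hm] with s hs
        rwa [hs]
      filter_upwards [h₁, h₂, eventually_gt_atTop v] with s h₁ h₂ hs
      rw [List.findIdx_eq (by simpa using hs)]
      simp only [List.getElem_range, decide_eq_true_eq, decide_eq_false_iff_not]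
      exact ⟨h₁, fun j hj => h₂ j (Finset.mem_range.2 hj)⟩

/-! ### Diagonal colorings -/

/-- The last stage `u ≤ s` for which the code `p` is seen, within `s` steps, to converge at
`(x, u)`. -/
def lastStage (p : Code) (x s : ℕ) : ℕ :=
  Nat.findGreatest (fun u => (p.evaln s (Nat.pair x u)).isSome = true) s

/-- For `i = ⟨p, x⟩`, the bit that differs at stage `s` from the current guess at
`lim_u p(x, u)`. -/
def antiLimit (i s : ℕ) : Fin 2 :=
  let p := Denumerable.ofNat Code i.unpair.1
  if p.evaln s (Nat.pair i.unpair.2 (lastStage p i.unpair.2 s)) = some 0 then 1 else 0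

theorem primrec_antiLimit : Primrec₂ antiLimit := by
  have hp : Primrec fun q : ℕ × ℕ => Denumerable.ofNat Code q.1.unpair.1 :=
    (Primrec.ofNat Code).comp (Primrec.fst.comp (Primrec.unpair.comp Primrec.fst))
  have hx : Primrec fun q : ℕ × ℕ => q.1.unpair.2 :=
    Primrec.snd.comp (Primrec.unpair.comp Primrec.fst)
  have hlast : Primrec fun q : ℕ × ℕ =>
      lastStage (Denumerable.ofNat Code q.1.unpair.1) q.1.unpair.2 q.2 := by
    refine Primrec.nat_findGreatest Primrec.snd
      (p := fun (q : ℕ × ℕ) u => ((Denumerable.ofNat Code q.1.unpair.1).evaln q.2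
        (Nat.pair q.1.unpair.2 u)).isSome = true) ?_
    have heval : Primrec fun r : (ℕ × ℕ) × ℕ => (Denumerable.ofNat Code r.1.1.unpair.1).evaln r.1.2
        (Nat.pair r.1.1.unpair.2 r.2) :=
      Code.primrec_evaln.comp (((Primrec.snd.comp Primrec.fst).pair (hp.comp Primrec.fst)).pair
        (Primrec₂.natPair.comp (hx.comp Primrec.fst) Primrec.snd))
    exact Primrec.eq.comp (Primrec.option_isSome.comp heval) (Primrec.const true)
  have heval : Primrec fun q : ℕ × ℕ => (Denumerable.ofNat Code q.1.unpair.1).evaln q.2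
      (Nat.pair q.1.unpair.2 (lastStage (Denumerable.ofNat Code q.1.unpair.1) q.1.unpair.2 q.2)) :=
    Code.primrec_evaln.comp ((Primrec.snd.pair hp).pair (Primrec₂.natPair.comp hx hlast))
  exact Primrec.ite (Primrec.eq.comp heval (Primrec.const (some 0)))
    (Primrec.const 1) (Primrec.const 0)

theorem eventually_antiLimit {G : ℕ → ℕ → ℕ} (hG : Primrec₂ G) :
    ∃ p : ℕ, ∀ x v, (∀ᶠ s in atTop, G x s = v) →
      ∀ᶠ s in atTop, antiLimit (Nat.pair p x) s = if v = 0 then 1 else 0 := by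
  obtain ⟨p, hp⟩ := Code.exists_code.1 (Partrec.nat_iff.1
    (hG.comp (Primrec.fst.comp Primrec.unpair) (Primrec.snd.comp Primrec.unpair)).to_comp.partrec)
  have heval (x u w : ℕ) : w ∈ p.eval (Nat.pair x u) ↔ w = G x u := by
    rw [hp]; simp
  refine ⟨encode p, fun x v hv => ?_⟩
  obtain ⟨N, hN⟩ := eventually_atTop.1 hv
  obtain ⟨k, hk⟩ := Code.evaln_complete.1 ((heval x N _).2 rfl)
  filter_upwards [eventually_ge_atTop k, eventually_ge_atTop N] with s hks hNs
  have hNsome : (p.evaln s (Nat.pair x N)).isSome = true := by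
    have := Code.evaln_mono hks hk
    rw [Option.mem_def] at this
    simp [this]
  -- Convergence at the settled stage `N` is already visible, so the last visible stage is no
  -- earlier and shows the limit value.
  have hle : N ≤ lastStage p x s := Nat.le_findGreatest hNs hNsome
  have hspec : (p.evaln s (Nat.pair x (lastStage p x s))).isSome = true :=
    Nat.findGreatest_spec (P := fun u => (p.evaln s (Nat.pair x u)).isSome = true) hNs hNsome
  obtain ⟨w, hw⟩ := Option.isSome_iff_exists.1 hspec
  have hwv : w = v := ((heval _ _ _).1 (Code.evaln_sound hw)).trans (hN _ hle)
  subst hwv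
  simp [antiLimit, hw]

/-! ### Limit colors read off from a solution -/

theorem IsInfiniteVariableWord.strictMono {A : Type*} {W : ℕ → A ⊕ ℕ}
    (hW : IsInfiniteVariableWord W) : StrictMono (firstOcc W) :=
  strictMono_nat_of_lt_succ hW.first_lt

theorem length_substWord {A : Type*} [Inhabited A] (W : ℕ → A ⊕ ℕ) (a : List A) :
    (substWord W a).length = firstOcc W a.length := by
  simp [substWord]

/-- If the colorings depend on the length only, then the color of the `i`-th coloring on the
strings `W(b)` with `|b| ≥ i` is its limit color. -/
theorem IsSeqOVWSolution.eq_of_eventually {A κ : Type*} [Inhabited A] {C : ℕ → ℕ → κ}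
    {W : ℕ → A ⊕ ℕ} (hW : IsSeqOVWSolution (fun i τ => C i τ.length) W) {i : ℕ} {v : κ}
    (hv : ∀ᶠ s in atTop, C i s = v) : C i (firstOcc W i) = v := by
  obtain ⟨color, hcolor⟩ := hW.2 i (List.replicate i default) (by simp)
  have hC (j : ℕ) : C i (firstOcc W (i + j)) = color := by
    simpa [length_substWord] using hcolor (List.replicate j default)
  have htend : Tendsto (fun j => firstOcc W (i + j)) atTop atTop :=
    (hW.1.strictMono.comp (fun _ _ h => Nat.add_lt_add_left h i)).tendsto_atTop
  -- Some length in the monochromatic set lies where the limit is reached; constancy carries the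
  -- color back to `j = 0`.
  obtain ⟨j, hj⟩ := (htend.eventually hv).exists
  rw [← hj, hC j]
  exact hC 0

/-! ### Guessing which child dies first -/

/-- The list of all binary strings of length `n`. -/
def binaryStrings : ℕ → List (List Bool)
  | 0 => [[]]
  | n + 1 => (binaryStrings n).flatMap fun τ => [false :: τ, true :: τ]

theorem mem_binaryStrings {n : ℕ} {τ : List Bool} : τ ∈ binaryStrings n ↔ τ.length = n := by
  induction n generalizing τ with
  | zero => simp [binaryStrings]
  | succ n ih =>
    cases τ with
    | nil => simp [binaryStrings]
    | cons b τ => cases b <;> simp [binaryStrings, ih]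

theorem primrec_binaryStrings : Primrec binaryStrings := by
  refine (Primrec.nat_rec₁ (f := fun _ (l : List (List Bool)) =>
    l.flatMap fun τ => [false :: τ, true :: τ]) [[]] ?_).of_eq fun n => ?_
  · refine Primrec.list_flatMap Primrec.snd ?_
    exact Primrec.list_cons.comp (Primrec.list_cons.comp (Primrec.const false) Primrec.snd)
      (Primrec.list_cons.comp (Primrec.list_cons.comp (Primrec.const true) Primrec.snd)
        (Primrec.const []))
  · induction n with
    | zero => rfl
    | succ n ih => simp only [binaryStrings, ih]

/-- According to the guess `F · s` at the (coded) set of strings, the string `σ` has no extension by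
`n` bits. -/
def IsDeadAt (F : ℕ → ℕ → ℕ) (s : ℕ) (σ : List Bool) (n : ℕ) : Prop :=
  ∀ τ ∈ binaryStrings n, F (encode (σ ++ τ)) s ≠ 1

/-- According to the guess `F · s`, the child `σ0` dies before or together with the child `σ1`. -/
def FalseDiesFirst (F : ℕ → ℕ → ℕ) (s : ℕ) (σ : List Bool) : Prop :=
  ∃ n < s, IsDeadAt F s (σ ++ [false]) n ∧ ∀ m < n, ¬ IsDeadAt F s (σ ++ [true]) m

theorem primrecPred_isDeadAt {F : ℕ → ℕ → ℕ} (hF : Primrec₂ F) :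
    PrimrecPred fun q : (ℕ × List Bool) × ℕ => IsDeadAt F q.1.1 q.1.2 q.2 := by
  have : PrimrecRel fun (τ : List Bool) (q : ℕ × List Bool) =>
      F (encode (q.2 ++ τ)) q.1 ≠ 1 :=
    PrimrecPred.not (Primrec.eq.comp (hF.comp (Primrec.encode.comp
      (Primrec.list_append.comp (Primrec.snd.comp Primrec.snd) Primrec.fst))
      (Primrec.fst.comp Primrec.snd)) (Primrec.const 1))
  exact this.forall_mem_list.comp (primrec_binaryStrings.comp Primrec.snd) Primrec.fst

theorem primrecPred_falseDiesFirst {F : ℕ → ℕ → ℕ} (hF : Primrec₂ F) :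
    PrimrecPred fun q : ℕ × List Bool => FalseDiesFirst F q.1 q.2 := by
  have hdead (b : Bool) : PrimrecRel fun (n : ℕ) (q : ℕ × List Bool) =>
      IsDeadAt F q.1 (q.2 ++ [b]) n :=
    (primrecPred_isDeadAt hF).comp (((Primrec.fst.comp Primrec.snd).pair
      (Primrec.list_append.comp (Primrec.snd.comp Primrec.snd) (Primrec.const [b]))).pair
        Primrec.fst)
  have hnot : PrimrecRel fun (n : ℕ) (q : ℕ × List Bool) => ¬ IsDeadAt F q.1 (q.2 ++ [true]) n :=
    PrimrecPred.not (hdead true)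
  have hall : PrimrecRel fun (n : ℕ) (q : ℕ × List Bool) =>
      ∀ m < n, ¬ IsDeadAt F q.1 (q.2 ++ [true]) m :=
    ((PrimrecRel.forall_mem_list hnot).comp
      (Primrec.list_range.comp Primrec.fst) Primrec.snd).of_eq (by simp)
  have hand : PrimrecRel fun (n : ℕ) (q : ℕ × List Bool) =>
      IsDeadAt F q.1 (q.2 ++ [false]) n ∧ ∀ m < n, ¬ IsDeadAt F q.1 (q.2 ++ [true]) m :=
    PrimrecPred.and (hdead false) hall
  exact (hand.exists_mem_list.comp (Primrec.list_range.comp Primrec.fst)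
    (Primrec.id (α := ℕ × List Bool))).of_eq (by simp [FalseDiesFirst])

/-! ### Extendible strings -/

/-- The string `σ` has extensions in `T` of every length. -/
def IsExtendible (T : List Bool → Bool) (σ : List Bool) : Prop :=
  ∀ n, ∃ τ : List Bool, τ.length = n ∧ T (σ ++ τ) = true

theorem IsInfiniteBinaryTree.isExtendible_nil {T : List Bool → Bool}
    (hT : IsInfiniteBinaryTree T) : IsExtendible T [] := by
  intro n
  obtain ⟨σ, hσ, hlen⟩ : ∃ σ, T σ = true ∧ n ≤ σ.length := by
    by_contra! h
    exact hT.2 ((List.finite_length_lt Bool n).subset fun σ hσ => h σ hσ)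
  exact ⟨σ.take n, by simpa using hlen, hT.1 _ σ (List.take_prefix n σ) hσ⟩

theorem IsExtendible.child {T : List Bool → Bool} (hT : IsInfiniteBinaryTree T) {σ : List Bool}
    (hσ : IsExtendible T σ) {b : Bool} (hb : ¬ IsExtendible T (σ ++ [b])) :
    IsExtendible T (σ ++ [!b]) := by
  simp only [IsExtendible, not_forall, not_exists, not_and] at hb
  obtain ⟨n₀, hn₀⟩ := hb
  intro n
  -- One bit picks the child; the remaining `n₀ + n` can be cut to `n₀`, which rules out the dead
  -- child, or to `n`.
  obtain ⟨τ, hlen, hτ⟩ := hσ (n₀ + n + 1)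
  obtain _ | ⟨a, τ⟩ := τ
  · simp at hlen
  replace hlen : τ.length = n₀ + n := by simpa using hlen
  have htake (k : ℕ) : T (σ ++ [a] ++ τ.take k) = true := by
    refine hT.1 _ _ ?_ hτ
    simpa using List.take_prefix k τ
  obtain rfl | rfl : a = b ∨ a = !b := by cases a <;> cases b <;> simp
  · exact absurd (htake n₀) (hn₀ _ (by simp [hlen]))
  · exact ⟨τ.take n, by simp [hlen], htake n⟩

/-- Only finitely many strings are involved at a fixed level, so their guesses settle
simultaneously. -/
theorem eventually_isDeadAt_iff {T : List Bool → Bool} {F : ℕ → ℕ → ℕ}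
    (hF : ∀ σ, ∀ᶠ s in atTop, F (encode σ) s = encode (T σ)) (σ : List Bool) (n : ℕ) :
    ∀ᶠ s in atTop, IsDeadAt F s σ n ↔ ¬ ∃ τ : List Bool, τ.length = n ∧ T (σ ++ τ) = true := by
  have : ∀ᶠ s in atTop, ∀ τ ∈ (binaryStrings n).toFinset,
      F (encode (σ ++ τ)) s = encode (T (σ ++ τ)) := by
    rw [eventually_all_finset]
    exact fun τ _ => hF _
  filter_upwards [this] with s hs
  simp only [IsDeadAt, not_exists, not_and, mem_binaryStrings]
  refine forall₂_congr fun τ hτ => ?_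
  rw [hs τ (by simpa [mem_binaryStrings] using hτ)]
  cases T (σ ++ τ) <;> simp

/-- A bit other than the limit of the guesses at the dying child leads to an extendible child. -/
theorem IsExtendible.child_of_limit {T : List Bool → Bool} (hT : IsInfiniteBinaryTree T)
    {F : ℕ → ℕ → ℕ} (hF : ∀ σ, ∀ᶠ s in atTop, F (encode σ) s = encode (T σ)) {σ : List Bool}
    (hσ : IsExtendible T σ) {b : Bool}
    (h₀ : (∀ᶠ s in atTop, FalseDiesFirst F s σ) → b = true)
    (h₁ : (∀ᶠ s in atTop, ¬ FalseDiesFirst F s σ) → b = false) :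
    IsExtendible T (σ ++ [b]) := by
  by_contra hb
  have hb' := hσ.child hT hb
  obtain ⟨n₀, hn₀⟩ := not_forall.1 hb
  have hdead := eventually_isDeadAt_iff hF (σ ++ [b]) n₀
  have halive : ∀ᶠ s in atTop, ∀ m ∈ Finset.range (n₀ + 1), ¬ IsDeadAt F s (σ ++ [!b]) m := by
    rw [eventually_all_finset]
    intro m _
    filter_upwards [eventually_isDeadAt_iff hF (σ ++ [!b]) m] with s hs
    rw [hs, not_not]
    exact hb' m
  cases b with
  | false =>
    refine absurd (h₀ ?_) (by simp)
    filter_upwards [hdead, halive, eventually_gt_atTop n₀] with s hd ha hs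
    exact ⟨n₀, hs, hd.2 hn₀, fun m hm => ha m (Finset.mem_range.2 (by omega))⟩
  | true =>
    refine absurd (h₁ ?_) (by simp)
    filter_upwards [hdead, halive] with s hd ha
    rintro ⟨n, -, hn, hlt⟩
    -- Guesses about the false child at levels above `n₀` need not have settled, but there the true
    -- child is already seen dead at `n₀`.
    rcases le_or_gt n n₀ with h | h
    · exact ha n (Finset.mem_range.2 (by omega)) hn
    · exact hlt n₀ h (hd.2 hn₀)

/-! ### Diagonalizing against the tree -/

/-- The binary string with the given code, or the empty string. -/
def binaryStringOfNat (x : ℕ) : List Bool :=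
  (decode x).getD []

theorem primrec_binaryStringOfNat : Primrec binaryStringOfNat :=
  Primrec.option_getD.comp Primrec.decode (Primrec.const [])

@[simp]
theorem binaryStringOfNat_encode (σ : List Bool) : binaryStringOfNat (encode σ) = σ := by
  simp [binaryStringOfNat]

theorem exists_isLimitApprox_tree {T : List Bool → Bool}
    (hT : ComputableIn {(zeroJump : ℕ →. ℕ)} T) :
    ∃ F : ℕ → ℕ → ℕ, Primrec₂ F ∧ ∀ σ, ∀ᶠ s in atTop, F (encode σ) s = encode (T σ) := by
  obtain ⟨F, hF, hl⟩ := exists_isLimitApprox (fun g hg => by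
    rw [Set.mem_singleton_iff.1 hg]
    exact ⟨_, isLimitApprox_zeroJump⟩) hT
  exact ⟨F, hF, fun σ => hl _ _ (by simp)⟩

/-- For some `p`, the limits of the diagonal functions with indices `⟨p, σ⟩` lead along extendible
strings of `T`. -/
theorem exists_index_isExtendible_child {T : List Bool → Bool}
    (hTc : ComputableIn {(zeroJump : ℕ →. ℕ)} T) (hT : IsInfiniteBinaryTree T) :
    ∃ p : ℕ, ∀ σ, IsExtendible T σ → ∀ v : Fin 2,
      (∀ w, (∀ᶠ s in atTop, antiLimit (Nat.pair p (encode σ)) s = w) → v = w) →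
        IsExtendible T (σ ++ [decide (v = 1)]) := by
  classical
  obtain ⟨F, hF, hFl⟩ := exists_isLimitApprox_tree hTc
  -- The guess names the bit of the dying child, so `antiLimit` tends to the bit of the other one.
  obtain ⟨p, hp⟩ := eventually_antiLimit (G := fun x s =>
      if FalseDiesFirst F s (binaryStringOfNat x) then 0 else 1)
    (Primrec.ite ((primrecPred_falseDiesFirst hF).comp (Primrec.snd.pair
      (primrec_binaryStringOfNat.comp Primrec.fst))) (Primrec.const 0) (Primrec.const 1))
  refine ⟨p, fun σ hσ v hv => hσ.child_of_limit hT hFl (fun h => ?_) fun h => ?_⟩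
  · have := hv 1 (hp (encode σ) 0 (by simpa using h))
    simp [this]
  · have := hv 0 (hp (encode σ) 1 (by simpa using h))
    simp [this]

/-! ### Computability relative to the solution -/

theorem ComputableIn.comp_nat {O : Set (ℕ →. ℕ)} {f g : ℕ → ℕ}
    (hf : ComputableIn O f) (hg : ComputableIn O g) : ComputableIn O fun n => f (g n) := by
  have := Nat.RecursiveIn.comp (RecursiveIn.iff_nat.1 hf) (RecursiveIn.iff_nat.1 hg)
  exact RecursiveIn.iff_nat.2 (this.of_eq fun n => by simp)

theorem ComputableIn.pair_nat {O : Set (ℕ →. ℕ)} {f g : ℕ → ℕ}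
    (hf : ComputableIn O f) (hg : ComputableIn O g) :
    ComputableIn O fun n => Nat.pair (f n) (g n) := by
  have := Nat.RecursiveIn.pair (RecursiveIn.iff_nat.1 hf) (RecursiveIn.iff_nat.1 hg)
  exact RecursiveIn.iff_nat.2 (this.of_eq fun n => by simp [Seq.seq])

theorem ComputableIn.iterate_nat {O : Set (ℕ →. ℕ)} {f : ℕ → ℕ} (hf : ComputableIn O f)
    (a : ℕ) : ComputableIn O fun n => f^[n] a := by
  have hstep : ComputableIn O fun q : ℕ => f q.unpair.2.unpair.2 :=
    hf.comp_nat (g := fun q : ℕ => q.unpair.2.unpair.2)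
      (Primrec.snd.comp (Primrec.unpair.comp (Primrec.snd.comp Primrec.unpair))).computableIn
  have hrec := Nat.RecursiveIn.prec (RecursiveIn.iff_nat.1 (ComputableIn.const (O := O) a))
    (RecursiveIn.iff_nat.1 hstep)
  have htot : ComputableIn O fun q : ℕ => f^[q.unpair.2] a := by
    refine RecursiveIn.iff_nat.2 (hrec.of_eq fun q => ?_)
    dsimp only
    generalize q.unpair.2 = n
    induction n with
    | zero => simp
    | succ n ih =>
      dsimp only at ih ⊢
      rw [ih]
      simp [Function.iterate_succ_apply']
  -- The recursion scheme expects a parameter; the dummy `0` fills it.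
  simpa using htot.comp_nat (g := fun n => Nat.pair 0 n)
    (Primrec₂.natPair.comp (Primrec.const 0) Primrec.id).computableIn

/-- Unbounded search through `W` halts because every variable occurs. -/
theorem firstOcc_computableIn {W : ℕ → Fin 2 ⊕ ℕ} (hW : IsInfiniteVariableWord W) :
    ComputableIn {((fun p => encode (W p) : ℕ → ℕ) : ℕ →. ℕ)} (firstOcc W) := by
  set O : Set (ℕ →. ℕ) := {((fun p => encode (W p) : ℕ → ℕ) : ℕ →. ℕ)}
  have horacle : ComputableIn O fun p => encode (W p) := RecursiveIn.oracle _ rfl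
  have htest : ComputableIn O fun q : ℕ =>
      if encode (W q.unpair.2) = encode (Sum.inr q.unpair.1 : Fin 2 ⊕ ℕ) then 0 else 1 := by
    have h₁ : ComputableIn O fun q : ℕ =>
        Nat.pair (encode (W q.unpair.2)) (encode (Sum.inr q.unpair.1 : Fin 2 ⊕ ℕ)) :=
      (horacle.comp_nat (g := fun q : ℕ => q.unpair.2)
        (Primrec.snd.comp Primrec.unpair).computableIn).pair_nat
      (Primrec.encode.comp (Primrec.sumInr.comp
        (Primrec.fst.comp Primrec.unpair))).computableIn
    have h₂ : ComputableIn O fun q : ℕ => if q.unpair.1 = q.unpair.2 then 0 else 1 :=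
      (Primrec.ite (Primrec.eq.comp (Primrec.fst.comp Primrec.unpair)
        (Primrec.snd.comp Primrec.unpair)) (Primrec.const 0) (Primrec.const 1)).computableIn
    exact (h₂.comp_nat h₁).of_eq fun q => by simp only [Nat.unpair_pair]
  refine RecursiveIn.iff_nat.2 ((Nat.RecursiveIn.rfind (RecursiveIn.iff_nat.1 htest)).of_eq
    fun k => ?_)
  refine Part.eq_some_iff.2 (Nat.mem_rfind.2 ?_)
  have hmem : firstOcc W k ∈ {p | W p = Sum.inr k} := Nat.sInf_mem (hW.occurs k)
  have hnot {m : ℕ} (hm : m < firstOcc W k) : W m ≠ Sum.inr k := Nat.notMem_of_lt_sInf hm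
  refine ⟨?_, fun {m} hm => ?_⟩
  · simpa [-encode_inr] using hmem
  · simpa [-encode_inr] using hnot hm

/-! ### Computing a path from a solution -/

/-- Every solution of the instance that colors a string `τ` by `antiLimit i |τ|` is of PA degree
relative to `∅'`. -/
theorem IsSeqOVWSolution.isPARelativeTo {W : ℕ → Fin 2 ⊕ ℕ}
    (hW : IsSeqOVWSolution (fun i τ => antiLimit i τ.length) W) :
    IsPARelativeTo zeroJump fun p => encode (W p) := by
  intro T hTc hT
  obtain ⟨p, hp⟩ := exists_index_isExtendible_child hTc hT
  set O : Set (ℕ →. ℕ) := {((fun p => encode (W p) : ℕ → ℕ) : ℕ →. ℕ)}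
  let h : List Bool → Bool := fun σ =>
    decide (antiLimit (Nat.pair p (encode σ)) (firstOcc W (Nat.pair p (encode σ))) = 1)
  have hext (σ : List Bool) (hσ : IsExtendible T σ) : IsExtendible T (σ ++ [h σ]) :=
    hp σ hσ _ fun w hw => hW.eq_of_eventually hw
  let step : List Bool → List Bool := fun σ => σ ++ [h σ]
  let f : ℕ → Bool := fun n => h (step^[n] [])
  have hrange (n : ℕ) : (List.range n).map f = step^[n] [] := by
    induction n with
    | zero => rfl
    | succ n ih => rw [List.range_succ, List.map_append, ih, Function.iterate_succ_apply']; rfl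
  refine ⟨f, ?_, fun n => ?_⟩
  · have hidx : ComputableIn O fun x : ℕ => Nat.pair p x :=
      (Primrec₂.natPair.comp (Primrec.const p) Primrec.id).computableIn
    have hcode : ComputableIn O fun x : ℕ => encode (binaryStringOfNat x) :=
      (Primrec.encode.comp primrec_binaryStringOfNat).computableIn
    have hocc : ComputableIn O fun x : ℕ => firstOcc W (Nat.pair p x) :=
      (firstOcc_computableIn hW.1).comp_nat hidx
    have hval : ComputableIn O fun x : ℕ => encode (h (binaryStringOfNat x)) := by
      have h₁ : ComputableIn O fun q : ℕ =>
          encode (decide (antiLimit q.unpair.1 q.unpair.2 = 1)) :=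
        (Primrec.encode.comp (PrimrecPred.decide (Primrec.eq.comp (primrec_antiLimit.comp
          (Primrec.fst.comp Primrec.unpair) (Primrec.snd.comp Primrec.unpair))
          (Primrec.const 1)))).computableIn
      simpa [h] using h₁.comp_nat ((hidx.pair_nat hocc).comp_nat hcode)
    have hstep : ComputableIn O fun x : ℕ => encode (step (binaryStringOfNat x)) := by
      have h₁ : ComputableIn O fun q : ℕ => encode (binaryStringOfNat q.unpair.1 ++
          [decide (q.unpair.2 = 1)]) :=
        (Primrec.encode.comp (Primrec.list_concat.comp
          (primrec_binaryStringOfNat.comp (Primrec.fst.comp Primrec.unpair))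
          (Primrec.eq.comp (Primrec.snd.comp Primrec.unpair) (Primrec.const 1)).decide)
          ).computableIn
      have hone (b : Bool) : decide (encode b = 1) = b := by cases b <;> simp
      simpa [step, hone] using h₁.comp_nat ((ComputableIn.id).pair_nat hval)
    have hiter (n : ℕ) : (fun x : ℕ => encode (step (binaryStringOfNat x)))^[n]
        (encode ([] : List Bool)) = encode (step^[n] []) := by
      induction n with
      | zero => rfl
      | succ n ih =>
        rw [Function.iterate_succ_apply', ih, Function.iterate_succ_apply',
          binaryStringOfNat_encode]
    have hnat : ComputableIn O fun n => encode (f n) := by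
      have := hval.comp_nat (hstep.iterate_nat (encode ([] : List Bool)))
      simp only [hiter, binaryStringOfNat_encode] at this
      exact this
    simpa [ComputableIn, RecursiveIn] using hnat
  · rw [hrange]
    -- Extendibility is the invariant of the iteration; at level `0` it is membership in `T`.
    have : IsExtendible T (step^[n] []) := by
      induction n with
      | zero => exact hT.isExtendible_nil
      | succ n ih => rw [Function.iterate_succ_apply']; exact hext _ ih
    obtain ⟨τ, hτ, h⟩ := this 0
    simpa [List.length_eq_zero_iff.1 hτ] using h

/-- There is a computable instance of `Seq OVW(2,2)` every solution of which is of PA degree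
relative to `∅'`. -/
theorem mainTheorem6 :
    ∃ c : ℕ → List (Fin 2) → Fin 2, Computable₂ c ∧
      ∀ W : ℕ → Fin 2 ⊕ ℕ, IsSeqOVWSolution c W →
        IsPARelativeTo zeroJump (fun p => encode (W p)) :=
  ⟨fun i τ => antiLimit i τ.length,
    (primrec_antiLimit.comp Primrec.fst (Primrec.list_length.comp Primrec.snd)).to_comp,
    fun _ hW => hW.isPARelativeTo⟩
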